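/- Let $\Omega\subset\mathbb{R}^2$ be measurable with finite area, $K\in\mathbb{N}$, $\sigma>0$, $\lambda>0$, and let $f=(f_1,\dots,f_K)$ with $f_k:\Omega\to\mathbb{R}$ integrable. Let $G_\sigma(x)=\frac{1}{2\pi\sigma^2}\exp\left(-\frac{\|x\|^2}{2\sigma^2}\right)$ and $(G_\sigma*w)(x)=\int_\Omega G_\sigma(x-y)\,w(y)\,dy$. Let $S$ be the set of measurable $v=(v_1,\dots,v_K):\Omega\to\mathbb{R}^K$ with $v_k(x)\ge 0$ and $\sum_{k=1}^K v_k(x)=1$ for almost every $x\in\Omega$. For $\varepsilon\ge 0$ and $v\in S$ put $$F_\varepsilon(v)=\int_\Omega \sum_{k=1}^K v_kf_k\,dx+\varepsilon\int_\Omega\sum_{k=1}^K v_k\ln v_k\,dx+\frac{\lambda}{2}\int_\Omega\sum_{k=1}^K v_k\,\bigl(G_\sigma*(1-v_k)\bigr)\,dx ,$$ with $0\ln 0=0$. Then, as $\varepsilon\to0$, minimizers of $F_\varepsilon$ over $S$ become binary, in the following sense. (a) For all $\delta,\eta>0$ there is $\varepsilon_0>0$ such that for every $\varepsilon\in(0,\varepsilon_0)$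 and every minimizer $u$ of $F_\varepsilon$ over $S$, the set $\{x\in\Omega:\ \mathrm{dist}(u(x),\{0,1\}^K)\ge\delta\}$ (distance in the maximum norm) has area at most $\eta$. (b) Let $\varepsilon_n>0$, $\varepsilon_n\to0$, and let $u_n$ be a minimizer of $F_{\varepsilon_n}$ over $S$ for each $n$. Then there are a subsequence $(u_{n_j})$ and a minimizer $u$ of $F_0$ over $S$ such that, for almost every $x\in\Omega$, $u(x)\in\{0,1\}^K$ and $u_{n_j}(x)\to u(x)$. Moreover, if the whole sequence converges weakly to some integrable $u:\Omega\to\mathbb{R}^K$, in the sense that $\int_A u_n\,dx\to\int_A u\,dx$ for every measurable $A\subseteq\Omega$, then $u$ is a minimizer of $F_0$ over $S$ and, for almost every $x\in\Omega$, $u(x)\in\{0,1\}^K$ and $u_n(x)\to u(x)$. (c) Every minimizer $u$ of $F_0$ over $S$ satisfies $u(x)\in\{0,1\}^K$ for almost every $x\in\Omega$. -/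

import Mathlib

open MeasureTheory Filter Topology

noncomputable section

/-- The plane `ℝ²` with its Euclidean norm. -/
abbrev Plane : Type := EuclideanSpace ℝ (Fin 2)

/-- The Gaussian kernel `G_σ(x) = 1 / (2 π σ²) * exp (-‖x‖² / (2 σ²))` on the plane. -/
def gaussKernel (σ : ℝ) (x : Plane) : ℝ :=
  1 / (2 * Real.pi * σ ^ 2) * Real.exp (-‖x‖ ^ 2 / (2 * σ ^ 2))

/-- The convolution `G_σ * w` of the Gaussian kernel with a function `w` on `Ω` (extended by zero
outside `Ω`), i.e. `x ↦ ∫ y in Ω, w y * G_σ (x - y)`. -/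
def gaussConv (Ω : Set Plane) (σ : ℝ) (w : Plane → ℝ) : Plane → ℝ :=
  convolution (Ω.indicator w) (gaussKernel σ) (ContinuousLinearMap.mul ℝ ℝ) volume

/-- The admissible set `S`: measurable functions on `Ω` (up to null sets) with values in the
simplex `{w : w_k ≥ 0, ∑ k, w_k = 1}`. -/
def simplexFunctions (Ω : Set Plane) (K : ℕ) : Set (Plane → Fin K → ℝ) :=
  {v | AEStronglyMeasurable v (volume.restrict Ω) ∧
    ∀ᵐ x ∂(volume.restrict Ω), v x ∈ stdSimplex ℝ (Fin K)}

/-- The functional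
`F_ε(v) = ∫_Ω v·f + ε ∫_Ω v·ln v + (λ/2) ∫_Ω v·(G_σ * (1 - v))`, with `0 ln 0 = 0`. -/
def pottsEnergy {K : ℕ} (Ω : Set Plane) (σ lam : ℝ) (f : Plane → Fin K → ℝ) (ε : ℝ)
    (v : Plane → Fin K → ℝ) : ℝ :=
  (∫ x in Ω, ∑ k, v x k * f x k)
    + ε * (∫ x in Ω, ∑ k, v x k * Real.log (v x k))
    + lam / 2 * (∫ x in Ω, ∑ k, v x k * gaussConv Ω σ (fun y => 1 - v y k) x)

/-- `v` minimizes `F_ε` over the admissible set. -/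
def IsPottsMinimizer {K : ℕ} (Ω : Set Plane) (σ lam : ℝ) (f : Plane → Fin K → ℝ) (ε : ℝ)
    (v : Plane → Fin K → ℝ) : Prop :=
  v ∈ simplexFunctions Ω K ∧ IsMinOn (pottsEnergy Ω σ lam f ε) (simplexFunctions Ω K) v

/-- The set `{0, 1}^K`. -/
def binaryVectors (K : ℕ) : Set (Fin K → ℝ) := {w | ∀ k, w k = 0 ∨ w k = 1}

end

/-! Since the components of an admissible `v` sum to one, the nonlocal term equals a constant minus
`lam / 2` times the sum over `k` of the quadratic forms `∫ v_k (G_σ * v_k)`. The Fourier transform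
of a Gaussian is a positive Gaussian, so this form is positive definite
(`integral_mul_gaussPotential_self`, `ae_eq_zero_of_integral_mul_gaussPotential_self_nonpos`), and
`F_0` is strictly concave on a convex set whose extreme points are the binary functions.

Quantitatively, `F_ε(v) - F_ε(u)` is a pointwise comparison of the linearized cost plus entropy,
minus a positive definite form in `v - u` (`pottsEnergy_sub`). Testing a minimizer `u` against its
replacement by a vertex `e_i` on an arbitrary measurable set `A` shows that `u(x)` does at least as
well as every vertex in the linearized problem. For `ε = 0`, taking for `A` the set where `e_i` does
no worse than `u` forces the form to vanish, so `u = e_i` on `A` (`IsPottsMinimizer.ae_eq_one`).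
Hence `u` is binary and, almost everywhere, the linearized cost has a unique minimal index.

For `ε_n → 0`, weak compactness gives a weakly convergent subsequence. Gaussian smoothing turns weak
convergence into pointwise convergence of the potentials, so the energies converge and the weak
limit minimizes `F_0`. Almost everywhere, `u_n(x)` minimizes a convergent sequence of linear costs
up to an error `ε_n K`, and the limit cost has a unique minimal index. This forces `u_n(x)` to
converge to the corresponding vertex (`tendsto_of_linear_le`). The uniform statement in measure
follows by contradiction from the subsequence statement. -/

/-- The Gaussian potential `x ↦ ∫ w(y) G_σ(x - y) dμ(y)` of the signed measure `w μ`. -/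
noncomputable def gaussPotential (μ : Measure Plane) (σ : ℝ) (w : Plane → ℝ) (x : Plane) : ℝ :=
  ∫ y, w y * gaussKernel σ (x - y) ∂μ

theorem gaussConv_eq_gaussPotential {Ω : Set Plane} (hΩ : MeasurableSet Ω) (σ : ℝ)
    (w : Plane → ℝ) : gaussConv Ω σ w = gaussPotential (volume.restrict Ω) σ w := by
  ext x
  rw [gaussConv, gaussPotential, convolution, ← integral_indicator hΩ]
  congr 1
  ext y
  by_cases hy : y ∈ Ω <;> simp [hy]

theorem continuous_gaussKernel (σ : ℝ) : Continuous (gaussKernel σ) := by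
  unfold gaussKernel
  fun_prop

theorem gaussKernel_neg (σ : ℝ) (x : Plane) : gaussKernel σ (-x) = gaussKernel σ x := by
  simp [gaussKernel]

theorem gaussKernel_sub_comm (σ : ℝ) (x y : Plane) :
    gaussKernel σ (x - y) = gaussKernel σ (y - x) := by
  rw [← gaussKernel_neg, neg_sub]

theorem abs_gaussKernel_le (σ : ℝ) (x : Plane) :
    |gaussKernel σ x| ≤ 1 / (2 * Real.pi * σ ^ 2) := by
  have h0 : 0 ≤ 1 / (2 * Real.pi * σ ^ 2) := by positivity
  have h1 : Real.exp (-‖x‖ ^ 2 / (2 * σ ^ 2)) ≤ 1 := by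
    rw [Real.exp_le_one_iff, neg_div]
    exact neg_nonpos.2 (by positivity)
  rw [gaussKernel, abs_mul, abs_of_nonneg h0, abs_of_pos (Real.exp_pos _)]
  exact mul_le_of_le_one_right h0 h1

/-! ### Bounds, continuity and symmetry of the Gaussian potential. -/

section Potential

variable {μ : Measure Plane} {σ : ℝ} {v w : Plane → ℝ}

theorem integrable_mul_gaussKernel (hw : Integrable w μ) (x : Plane) :
    Integrable (fun y => w y * gaussKernel σ (x - y)) μ :=
  hw.mul_bdd
    ((continuous_gaussKernel σ).comp (continuous_const.sub continuous_id)).aestronglyMeasurable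
    (ae_of_all _ fun y => abs_gaussKernel_le σ (x - y))

theorem continuous_gaussPotential (hw : Integrable w μ) :
    Continuous (gaussPotential μ σ w) := by
  refine continuous_of_dominated (bound := fun y => ‖w y‖ * (1 / (2 * Real.pi * σ ^ 2)))
    (fun x => (integrable_mul_gaussKernel hw x).1) (fun x => ae_of_all _ fun y => ?_)
    (hw.norm.mul_const _) (ae_of_all _ fun y => ?_)
  · rw [norm_mul]
    exact mul_le_mul_of_nonneg_left (abs_gaussKernel_le _ _) (norm_nonneg _)
  · exact continuous_const.mul ((continuous_gaussKernel σ).comp (by fun_prop))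

theorem abs_gaussPotential_le (hw : Integrable w μ) (x : Plane) :
    |gaussPotential μ σ w x| ≤ (∫ y, ‖w y‖ ∂μ) * (1 / (2 * Real.pi * σ ^ 2)) := by
  rw [← integral_mul_const (μ := μ), ← Real.norm_eq_abs, gaussPotential]
  refine norm_integral_le_of_norm_le (hw.norm.mul_const _) (ae_of_all _ fun y => ?_)
  rw [norm_mul]
  exact mul_le_mul_of_nonneg_left (abs_gaussKernel_le _ _) (norm_nonneg _)

theorem gaussPotential_sub (hv : Integrable v μ) (hw : Integrable w μ) (x : Plane) :
    gaussPotential μ σ (fun y => v y - w y) x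
      = gaussPotential μ σ v x - gaussPotential μ σ w x := by
  rw [gaussPotential, gaussPotential, gaussPotential, ← integral_sub
    (integrable_mul_gaussKernel hv x) (integrable_mul_gaussKernel hw x)]
  simp only [sub_mul]

theorem integrable_mul_gaussPotential (hv : Integrable v μ) (hw : Integrable w μ) :
    Integrable (fun x => v x * gaussPotential μ σ w x) μ :=
  hv.mul_bdd (continuous_gaussPotential hw).aestronglyMeasurable
    (ae_of_all _ fun x => abs_gaussPotential_le hw x)

/-- Fubini and the evenness of the kernel. The symmetry merges the two cross terms when the
quadratic form is expanded. -/
theorem integral_mul_gaussPotential_comm [SFinite μ] (hv : Integrable v μ) (hw : Integrable w μ) :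
    ∫ x, v x * gaussPotential μ σ w x ∂μ = ∫ x, w x * gaussPotential μ σ v x ∂μ := by
  have hint : Integrable (fun z : Plane × Plane => v z.1 * w z.2 * gaussKernel σ (z.1 - z.2))
      (μ.prod μ) :=
    (hv.mul_prod hw).mul_bdd ((continuous_gaussKernel σ).comp
      (continuous_fst.sub continuous_snd)).aestronglyMeasurable
      (ae_of_all _ fun z => abs_gaussKernel_le σ _)
  calc ∫ x, v x * gaussPotential μ σ w x ∂μ
      = ∫ x, ∫ y, v x * w y * gaussKernel σ (x - y) ∂μ ∂μ := by
        simp only [gaussPotential, ← integral_const_mul, mul_assoc]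
    _ = ∫ y, ∫ x, v x * w y * gaussKernel σ (x - y) ∂μ ∂μ := integral_integral_swap hint
    _ = ∫ x, w x * gaussPotential μ σ v x ∂μ := by
        simp only [gaussPotential, ← integral_const_mul]
        refine integral_congr_ae (ae_of_all _ fun y => integral_congr_ae (ae_of_all _ fun x => ?_))
        simp only [gaussKernel_sub_comm σ x y]
        ring

end Potential

/-! ### Positive definiteness of the Gaussian kernel via the Fourier transform. -/

section PositiveDefinite

open scoped RealInnerProductSpace

theorem integrable_exp_neg_mul_norm_sq {b : ℝ} (hb : 0 < b) :
    Integrable (fun ξ : Plane => Real.exp (-b * ‖ξ‖ ^ 2)) volume := by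
  have h := (GaussianFourier.integrable_cexp_neg_mul_sq_norm_add (V := Plane) (b := (b : ℂ))
    (by simpa using hb) 0 0).re
  refine h.congr (ae_of_all _ fun ξ => ?_)
  have : (-(b : ℂ) * (‖ξ‖ : ℂ) ^ 2 + 0 * ((⟪(0 : Plane), ξ⟫ : ℝ) : ℂ))
      = ((-b * ‖ξ‖ ^ 2 : ℝ) : ℂ) := by
    push_cast; ring
  simp only [this]
  exact Complex.exp_ofReal_re _

/-- The real part of the Fourier integral of a Gaussian with parameter `σ ^ 2 / 2`. -/
theorem gaussKernel_eq_integral_cos {σ : ℝ} (hσ : 0 < σ) (z : Plane) :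
    gaussKernel σ z = 1 / (4 * Real.pi ^ 2) *
      ∫ ξ : Plane, Real.exp (-(σ ^ 2 / 2) * ‖ξ‖ ^ 2) * Real.cos ⟪z, ξ⟫ := by
  have hb : 0 < ((σ ^ 2 / 2 : ℝ) : ℂ).re := by
    rw [Complex.ofReal_re]; positivity
  have h := GaussianFourier.integral_cexp_neg_mul_sq_norm_add hb Complex.I z
  have hi := GaussianFourier.integrable_cexp_neg_mul_sq_norm_add hb Complex.I z
  have h2 := congrArg Complex.re h
  have hre : ∀ ξ : Plane, (Complex.exp (-((σ ^ 2 / 2 : ℝ) : ℂ) * (‖ξ‖ : ℂ) ^ 2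
      + Complex.I * ((⟪z, ξ⟫ : ℝ) : ℂ))).re
      = Real.exp (-(σ ^ 2 / 2) * ‖ξ‖ ^ 2) * Real.cos ⟪z, ξ⟫ := by
    intro ξ
    rw [Complex.exp_re]
    congr 2 <;> simp [← Complex.ofReal_pow]
  rw [show (∫ ξ : Plane, Complex.exp (-((σ ^ 2 / 2 : ℝ) : ℂ) * (‖ξ‖ : ℂ) ^ 2
      + Complex.I * ((⟪z, ξ⟫ : ℝ) : ℂ))).re = ∫ ξ : Plane, (Complex.exp
      (-((σ ^ 2 / 2 : ℝ) : ℂ) * (‖ξ‖ : ℂ) ^ 2 + Complex.I * ((⟪z, ξ⟫ : ℝ) : ℂ))).re from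
      (integral_re hi).symm] at h2
  simp only [hre] at h2
  rw [h2]
  -- In dimension two the prefactor `(π / b) ^ (dim / 2)` is just `π / b`.
  have hfin : (Module.finrank ℝ Plane / 2 : ℂ) = 1 := by
    simp [Plane]
  rw [hfin, Complex.cpow_one]
  have : ((Real.pi : ℂ) / ((σ ^ 2 / 2 : ℝ) : ℂ) * Complex.exp (Complex.I ^ 2 * (‖z‖ : ℂ) ^ 2
      / (4 * ((σ ^ 2 / 2 : ℝ) : ℂ)))) = ((Real.pi / (σ ^ 2 / 2)
        * Real.exp (-‖z‖ ^ 2 / (2 * σ ^ 2)) : ℝ) : ℂ) := by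
    rw [Complex.I_sq]
    push_cast
    congr 2
    ring
  rw [this, Complex.ofReal_re, gaussKernel]
  have := Real.pi_pos
  field_simp
  ring

variable {μ : Measure Plane} {h : Plane → ℝ}

theorem integrable_mul_cos_inner (hh : Integrable h μ) (ξ : Plane) :
    Integrable (fun x => h x * Real.cos ⟪x, ξ⟫) μ :=
  hh.mul_bdd (c := 1) (by fun_prop) (ae_of_all _ fun _ => Real.abs_cos_le_one _)

theorem integrable_mul_sin_inner (hh : Integrable h μ) (ξ : Plane) :
    Integrable (fun x => h x * Real.sin ⟪x, ξ⟫) μ :=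
  hh.mul_bdd (c := 1) (by fun_prop) (ae_of_all _ fun _ => Real.abs_sin_le_one _)

theorem continuous_integral_mul_cos_inner (hh : Integrable h μ) :
    Continuous fun ξ : Plane => ∫ x, h x * Real.cos ⟪x, ξ⟫ ∂μ := by
  refine continuous_of_dominated (bound := fun x => ‖h x‖)
    (fun ξ => (integrable_mul_cos_inner hh ξ).1) (fun ξ => ae_of_all _ fun x => ?_) hh.norm
    (ae_of_all _ fun x => by fun_prop)
  rw [norm_mul]
  exact mul_le_of_le_one_right (norm_nonneg _) (Real.abs_cos_le_one _)

theorem continuous_integral_mul_sin_inner (hh : Integrable h μ) :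
    Continuous fun ξ : Plane => ∫ x, h x * Real.sin ⟪x, ξ⟫ ∂μ := by
  refine continuous_of_dominated (bound := fun x => ‖h x‖)
    (fun ξ => (integrable_mul_sin_inner hh ξ).1) (fun ξ => ae_of_all _ fun x => ?_) hh.norm
    (ae_of_all _ fun x => by fun_prop)
  rw [norm_mul]
  exact mul_le_of_le_one_right (norm_nonneg _) (Real.abs_sin_le_one _)

theorem norm_integral_mul_cos_inner_le (hh : Integrable h μ) (ξ : Plane) :
    ‖∫ x, h x * Real.cos ⟪x, ξ⟫ ∂μ‖ ≤ ∫ x, ‖h x‖ ∂μ := by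
  refine norm_integral_le_of_norm_le hh.norm (ae_of_all _ fun x => ?_)
  rw [norm_mul]
  exact mul_le_of_le_one_right (norm_nonneg _) (Real.abs_cos_le_one _)

theorem norm_integral_mul_sin_inner_le (hh : Integrable h μ) (ξ : Plane) :
    ‖∫ x, h x * Real.sin ⟪x, ξ⟫ ∂μ‖ ≤ ∫ x, ‖h x‖ ∂μ := by
  refine norm_integral_le_of_norm_le hh.norm (ae_of_all _ fun x => ?_)
  rw [norm_mul]
  exact mul_le_of_le_one_right (norm_nonneg _) (Real.abs_sin_le_one _)

/-- The addition formula for `cos ⟪x - y, ξ⟫` separates the variables `x` and `y`, so that a further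
integration against `h x` produces squares. -/
theorem gaussPotential_eq_integral [SFinite μ] {σ : ℝ} (hσ : 0 < σ) (hh : Integrable h μ)
    (x : Plane) :
    gaussPotential μ σ h x = 1 / (4 * Real.pi ^ 2) * ∫ ξ : Plane,
      Real.exp (-(σ ^ 2 / 2) * ‖ξ‖ ^ 2) *
        (Real.cos ⟪x, ξ⟫ * (∫ y, h y * Real.cos ⟪y, ξ⟫ ∂μ)
          + Real.sin ⟪x, ξ⟫ * (∫ y, h y * Real.sin ⟪y, ξ⟫ ∂μ)) := by
  have hg := integrable_exp_neg_mul_norm_sq (b := σ ^ 2 / 2) (by positivity)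
  have hint : Integrable (fun z : Plane × Plane => h z.1 * Real.exp (-(σ ^ 2 / 2) * ‖z.2‖ ^ 2)
      * Real.cos ⟪x - z.1, z.2⟫) (μ.prod volume) :=
    (hh.mul_prod hg).mul_bdd (c := 1) (by fun_prop) (ae_of_all _ fun _ => Real.abs_cos_le_one _)
  calc gaussPotential μ σ h x
      = 1 / (4 * Real.pi ^ 2) * ∫ y, (∫ ξ : Plane, h y * Real.exp (-(σ ^ 2 / 2) * ‖ξ‖ ^ 2)
          * Real.cos ⟪x - y, ξ⟫) ∂μ := by
        rw [gaussPotential, ← integral_const_mul (μ := μ)]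
        refine integral_congr_ae (ae_of_all _ fun y => ?_)
        simp only [gaussKernel_eq_integral_cos hσ, mul_assoc, integral_const_mul]
        ring
    _ = 1 / (4 * Real.pi ^ 2) * ∫ ξ : Plane, ∫ y, h y * Real.exp (-(σ ^ 2 / 2) * ‖ξ‖ ^ 2)
          * Real.cos ⟪x - y, ξ⟫ ∂μ := by
        rw [integral_integral_swap hint]
    _ = _ := by
        congr 1
        refine integral_congr_ae (ae_of_all _ fun ξ => ?_)
        simp only
        rw [← integral_const_mul, ← integral_const_mul, ← integral_add
          ((integrable_mul_cos_inner hh ξ).const_mul _)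
          ((integrable_mul_sin_inner hh ξ).const_mul _), ← integral_const_mul]
        refine integral_congr_ae (ae_of_all _ fun y => ?_)
        simp only [inner_sub_left, Real.cos_sub]
        ring

theorem integrable_exp_mul_sq_add_sq {b : ℝ} (hb : 0 < b) (hh : Integrable h μ) :
    Integrable (fun ξ : Plane => Real.exp (-b * ‖ξ‖ ^ 2) *
      ((∫ y, h y * Real.cos ⟪y, ξ⟫ ∂μ) ^ 2 + (∫ y, h y * Real.sin ⟪y, ξ⟫ ∂μ) ^ 2)) volume := by
  refine (integrable_exp_neg_mul_norm_sq hb).mul_bdd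
    (c := (∫ x, ‖h x‖ ∂μ) ^ 2 + (∫ x, ‖h x‖ ∂μ) ^ 2)
    (((continuous_integral_mul_cos_inner hh).pow 2).add
      ((continuous_integral_mul_sin_inner hh).pow 2)).aestronglyMeasurable
    (ae_of_all _ fun ξ => ?_)
  refine (norm_add_le _ _).trans ?_
  rw [norm_pow, norm_pow]
  gcongr
  · exact norm_integral_mul_cos_inner_le hh ξ
  · exact norm_integral_mul_sin_inner_le hh ξ

/-- Plancherel for the quadratic form: it is the integral of `|ĥ(ξ)|²` against a strictly positive
Gaussian weight, with cosine and sine integrals as real and imaginary parts of `ĥ`. -/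
theorem integral_mul_gaussPotential_self [SFinite μ] {σ : ℝ} (hσ : 0 < σ) (hh : Integrable h μ) :
    ∫ x, h x * gaussPotential μ σ h x ∂μ = 1 / (4 * Real.pi ^ 2) * ∫ ξ : Plane,
      Real.exp (-(σ ^ 2 / 2) * ‖ξ‖ ^ 2) *
        ((∫ y, h y * Real.cos ⟪y, ξ⟫ ∂μ) ^ 2 + (∫ y, h y * Real.sin ⟪y, ξ⟫ ∂μ) ^ 2) := by
  have hg := integrable_exp_neg_mul_norm_sq (b := σ ^ 2 / 2) (by positivity)
  set A : Plane → ℝ := fun ξ => ∫ y, h y * Real.cos ⟪y, ξ⟫ ∂μ with hA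
  set B : Plane → ℝ := fun ξ => ∫ y, h y * Real.sin ⟪y, ξ⟫ ∂μ with hB
  have hAc : Continuous A := continuous_integral_mul_cos_inner hh
  have hBc : Continuous B := continuous_integral_mul_sin_inner hh
  have hint : Integrable (fun z : Plane × Plane => h z.1 * Real.exp (-(σ ^ 2 / 2) * ‖z.2‖ ^ 2)
      * (Real.cos ⟪z.1, z.2⟫ * A z.2 + Real.sin ⟪z.1, z.2⟫ * B z.2)) (μ.prod volume) := by
    refine (hh.mul_prod hg).mul_bdd (c := (∫ x, ‖h x‖ ∂μ) + (∫ x, ‖h x‖ ∂μ)) ?_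
      (ae_of_all _ fun z => ?_)
    · exact Continuous.aestronglyMeasurable (by fun_prop)
    · refine (norm_add_le _ _).trans (add_le_add ?_ ?_)
      · rw [norm_mul]
        exact (mul_le_of_le_one_left (norm_nonneg _) (Real.abs_cos_le_one _)).trans
          (norm_integral_mul_cos_inner_le hh _)
      · rw [norm_mul]
        exact (mul_le_of_le_one_left (norm_nonneg _) (Real.abs_sin_le_one _)).trans
          (norm_integral_mul_sin_inner_le hh _)
  calc ∫ x, h x * gaussPotential μ σ h x ∂μ
      = 1 / (4 * Real.pi ^ 2) * ∫ x, (∫ ξ : Plane, h x * Real.exp (-(σ ^ 2 / 2) * ‖ξ‖ ^ 2)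
          * (Real.cos ⟪x, ξ⟫ * A ξ + Real.sin ⟪x, ξ⟫ * B ξ)) ∂μ := by
        rw [← integral_const_mul (μ := μ)]
        refine integral_congr_ae (ae_of_all _ fun x => ?_)
        simp only [gaussPotential_eq_integral hσ hh, mul_assoc, integral_const_mul]
        ring
    _ = 1 / (4 * Real.pi ^ 2) * ∫ ξ : Plane, ∫ x, h x * Real.exp (-(σ ^ 2 / 2) * ‖ξ‖ ^ 2)
          * (Real.cos ⟪x, ξ⟫ * A ξ + Real.sin ⟪x, ξ⟫ * B ξ) ∂μ := by
        rw [integral_integral_swap hint]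
    _ = _ := by
        congr 1
        refine integral_congr_ae (ae_of_all _ fun ξ => ?_)
        simp only
        rw [show (∫ y, h y * Real.cos ⟪y, ξ⟫ ∂μ) ^ 2
            = A ξ * ∫ y, h y * Real.cos ⟪y, ξ⟫ ∂μ from pow_two _,
          show (∫ y, h y * Real.sin ⟪y, ξ⟫ ∂μ) ^ 2
            = B ξ * ∫ y, h y * Real.sin ⟪y, ξ⟫ ∂μ from pow_two _, ← integral_const_mul, ← integral_const_mul, ← integral_add
          ((integrable_mul_cos_inner hh ξ).const_mul _)
          ((integrable_mul_sin_inner hh ξ).const_mul _), ← integral_const_mul]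
        refine integral_congr_ae (ae_of_all _ fun y => ?_)
        simp only
        ring

theorem integral_mul_gaussPotential_self_nonneg [SFinite μ] {σ : ℝ} (hσ : 0 < σ)
    (hh : Integrable h μ) : 0 ≤ ∫ x, h x * gaussPotential μ σ h x ∂μ := by
  rw [integral_mul_gaussPotential_self hσ hh]
  exact mul_nonneg (by positivity) (integral_nonneg fun ξ => by positivity)

/-- The hypotheses say that the finite measures `h⁺ μ` and `h⁻ μ` have equal characteristic
functions. They therefore coincide, so `h⁺ = h⁻` almost everywhere; as one of the two vanishes at
each point, both do. -/
theorem ae_eq_zero_of_integral_mul_cos_sin_eq_zero [IsFiniteMeasure μ] (hh : Integrable h μ)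
    (hcos : ∀ ξ : Plane, ∫ y, h y * Real.cos ⟪y, ξ⟫ ∂μ = 0)
    (hsin : ∀ ξ : Plane, ∫ y, h y * Real.sin ⟪y, ξ⟫ ∂μ = 0) : h =ᵐ[μ] 0 := by
  have hm : AEMeasurable h μ := hh.1.aemeasurable
  have hp : AEMeasurable (fun x => ENNReal.ofReal (h x)) μ := hm.ennreal_ofReal
  have hn : AEMeasurable (fun x => ENNReal.ofReal (-h x)) μ := hm.neg.ennreal_ofReal
  have hpf : ∫⁻ x, ENNReal.ofReal (h x) ∂μ ≠ ⊤ := hh.lintegral_lt_top.ne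
  have hnf : ∫⁻ x, ENNReal.ofReal (-h x) ∂μ ≠ ⊤ := hh.neg.lintegral_lt_top.ne
  have : IsFiniteMeasure (μ.withDensity fun x => ENNReal.ofReal (h x)) :=
    isFiniteMeasure_withDensity hpf
  have : IsFiniteMeasure (μ.withDensity fun x => ENNReal.ofReal (-h x)) :=
    isFiniteMeasure_withDensity hnf
  have key : (μ.withDensity fun x => ENNReal.ofReal (h x))
      = μ.withDensity fun x => ENNReal.ofReal (-h x) := by
    refine Measure.ext_of_charFun (funext fun ξ => ?_)
    rw [charFun_apply, charFun_apply,
      integral_withDensity_eq_integral_toReal_smul₀ hp (by simp),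
      integral_withDensity_eq_integral_toReal_smul₀ hn (by simp), ← sub_eq_zero]
    have hb : ∀ g : Plane → ℝ, Integrable g μ →
        Integrable (fun x => g x • Complex.exp ((⟪x, ξ⟫ : ℝ) * Complex.I)) μ := by
      intro g hg
      refine Integrable.smul_bdd (C := 1) hg (by fun_prop) (ae_of_all _ fun x => ?_)
      rw [Complex.norm_exp_ofReal_mul_I]
    rw [← integral_sub (hb _ (by simpa [ENNReal.toReal_ofReal'] using hh.real_toNNReal))
      (hb _ (by simpa [ENNReal.toReal_ofReal'] using hh.neg.real_toNNReal))]
    calc _ = ∫ x, (((h x * Real.cos ⟪x, ξ⟫ : ℝ) : ℂ)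
          + ((h x * Real.sin ⟪x, ξ⟫ : ℝ) : ℂ) * Complex.I) ∂μ := by
          refine integral_congr_ae (ae_of_all _ fun x => ?_)
          simp only
          rw [← sub_smul, ENNReal.toReal_ofReal', ENNReal.toReal_ofReal', max_zero_sub_eq_self,
            Complex.exp_mul_I, Complex.real_smul]
          push_cast
          ring
      _ = 0 := by
          rw [integral_add (integrable_mul_cos_inner hh ξ).ofReal
            ((integrable_mul_sin_inner hh ξ).ofReal.mul_const _), integral_mul_const,
            integral_complex_ofReal, integral_complex_ofReal, hcos, hsin]
          simp
  rw [withDensity_eq_iff hp hn hpf] at key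
  filter_upwards [key] with x hx
  rcases le_total (h x) 0 with h0 | h0
  · rw [ENNReal.ofReal_of_nonpos h0] at hx
    have := ENNReal.ofReal_eq_zero.1 hx.symm
    simp only [Pi.zero_apply]; linarith
  · rw [ENNReal.ofReal_of_nonpos (neg_nonpos.2 h0)] at hx
    have := ENNReal.ofReal_eq_zero.1 hx
    simp only [Pi.zero_apply]; linarith

/-- Strictness: the Gaussian weight never vanishes, so `ĥ = 0` almost everywhere, hence everywhere
by continuity, and Fourier uniqueness applies. -/
theorem ae_eq_zero_of_integral_mul_gaussPotential_self_nonpos [IsFiniteMeasure μ] {σ : ℝ}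
    (hσ : 0 < σ) (hh : Integrable h μ) (h0 : ∫ x, h x * gaussPotential μ σ h x ∂μ ≤ 0) :
    h =ᵐ[μ] 0 := by
  have h1 := le_antisymm h0 (integral_mul_gaussPotential_self_nonneg hσ hh)
  rw [integral_mul_gaussPotential_self hσ hh, mul_eq_zero,
    or_iff_right (by positivity), integral_eq_zero_iff_of_nonneg (fun ξ => by positivity)
      (integrable_exp_mul_sq_add_sq (by positivity) hh)] at h1
  have h2 : ∀ ξ : Plane, (∫ y, h y * Real.cos ⟪y, ξ⟫ ∂μ) ^ 2
      + (∫ y, h y * Real.sin ⟪y, ξ⟫ ∂μ) ^ 2 = 0 := by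
    have hc : Continuous fun ξ : Plane => (∫ y, h y * Real.cos ⟪y, ξ⟫ ∂μ) ^ 2
        + (∫ y, h y * Real.sin ⟪y, ξ⟫ ∂μ) ^ 2 :=
      ((continuous_integral_mul_cos_inner hh).pow 2).add
        ((continuous_integral_mul_sin_inner hh).pow 2)
    refine congrFun ((hc.ae_eq_iff_eq volume (continuous_const (y := (0 : ℝ)))).1 ?_)
    filter_upwards [h1] with ξ hξ
    exact (mul_eq_zero.1 hξ).resolve_left (Real.exp_pos _).ne'
  refine ae_eq_zero_of_integral_mul_cos_sin_eq_zero hh (fun ξ => ?_) (fun ξ => ?_)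
  · nlinarith [h2 ξ, sq_nonneg (∫ y, h y * Real.cos ⟪y, ξ⟫ ∂μ),
      sq_nonneg (∫ y, h y * Real.sin ⟪y, ξ⟫ ∂μ)]
  · nlinarith [h2 ξ, sq_nonneg (∫ y, h y * Real.cos ⟪y, ξ⟫ ∂μ),
      sq_nonneg (∫ y, h y * Real.sin ⟪y, ξ⟫ ∂μ)]

end PositiveDefinite

theorem abs_mul_log_le_one {t : ℝ} (h0 : 0 ≤ t) (h1 : t ≤ 1) : |t * Real.log t| ≤ 1 := by
  rw [mul_comm]
  rcases h0.eq_or_lt with rfl | h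
  · simp
  · exact (Real.abs_log_mul_self_lt t h h1).le

/-! ### Admissible functions and crude entropy bounds. -/

section Simplex

variable {K : ℕ} {Ω : Set Plane} {u v : Plane → Fin K → ℝ}

theorem simplexFunctions.aestronglyMeasurable (hu : u ∈ simplexFunctions Ω K) (k : Fin K) :
    AEStronglyMeasurable (fun x => u x k) (volume.restrict Ω) :=
  (continuous_apply k).comp_aestronglyMeasurable hu.1

theorem simplexFunctions.ae_mem_Icc (hu : u ∈ simplexFunctions Ω K) :
    ∀ᵐ x ∂(volume.restrict Ω), ∀ k, u x k ∈ Set.Icc (0 : ℝ) 1 :=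
  hu.2.mono fun _ hx k => mem_Icc_of_mem_stdSimplex hx k

theorem simplexFunctions.ae_norm_le_one (hu : u ∈ simplexFunctions Ω K) (k : Fin K) :
    ∀ᵐ x ∂(volume.restrict Ω), ‖u x k‖ ≤ 1 := by
  filter_upwards [simplexFunctions.ae_mem_Icc hu] with x hx
  rw [Real.norm_eq_abs, abs_of_nonneg (hx k).1]
  exact (hx k).2

theorem simplexFunctions.integrable_mul (hu : u ∈ simplexFunctions Ω K) (k : Fin K)
    {φ : Plane → ℝ} (hφ : Integrable φ (volume.restrict Ω)) :
    Integrable (fun x => u x k * φ x) (volume.restrict Ω) :=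
  hφ.bdd_mul (simplexFunctions.aestronglyMeasurable hu k)
    (simplexFunctions.ae_norm_le_one hu k)

theorem simplexFunctions.piecewise_mem (hu : u ∈ simplexFunctions Ω K)
    (hv : v ∈ simplexFunctions Ω K) {A : Set Plane} (hA : MeasurableSet A)
    [DecidablePred (· ∈ A)] : A.piecewise v u ∈ simplexFunctions Ω K := by
  refine ⟨AEStronglyMeasurable.piecewise hA hv.1.restrict hu.1.restrict, ?_⟩
  filter_upwards [hu.2, hv.2] with x h1 h2
  by_cases hx : x ∈ A <;> simpa [hx]

theorem const_single_mem_simplexFunctions (Ω : Set Plane) (i : Fin K) :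
    (fun _ => Pi.single i 1) ∈ simplexFunctions Ω K :=
  ⟨aestronglyMeasurable_const, ae_of_all _ fun _ => single_mem_stdSimplex ℝ i⟩

variable [IsFiniteMeasure (volume.restrict Ω)]

theorem simplexFunctions.integrable (hu : u ∈ simplexFunctions Ω K) (k : Fin K) :
    Integrable (fun x => u x k) (volume.restrict Ω) :=
  Integrable.of_bound (simplexFunctions.aestronglyMeasurable hu k) 1
    (simplexFunctions.ae_norm_le_one hu k)

theorem simplexFunctions.integrable_entropy (hu : u ∈ simplexFunctions Ω K) :
    Integrable (fun x => ∑ k, u x k * Real.log (u x k)) (volume.restrict Ω) := by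
  refine integrable_finsetSum _ fun k _ => Integrable.of_bound ?_ 1 ?_
  · exact Real.continuous_mul_log.comp_aestronglyMeasurable
      (simplexFunctions.aestronglyMeasurable hu k)
  · filter_upwards [simplexFunctions.ae_mem_Icc hu] with x hx
    exact abs_mul_log_le_one (hx k).1 (hx k).2

theorem neg_card_le_entropy {w : Fin K → ℝ} (hw : w ∈ stdSimplex ℝ (Fin K)) :
    -(K : ℝ) ≤ ∑ k, w k * Real.log (w k) := by
  calc -(K : ℝ) = ∑ _k : Fin K, (-1 : ℝ) := by simp
    _ ≤ _ := Finset.sum_le_sum fun k _ => (abs_le.1 (abs_mul_log_le_one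
        (mem_Icc_of_mem_stdSimplex hw k).1 (mem_Icc_of_mem_stdSimplex hw k).2)).1

theorem entropy_nonpos {w : Fin K → ℝ} (hw : w ∈ stdSimplex ℝ (Fin K)) :
    ∑ k, w k * Real.log (w k) ≤ 0 :=
  Finset.sum_nonpos fun k _ => mul_nonpos_of_nonneg_of_nonpos (hw.1 k)
    (Real.log_nonpos (hw.1 k) (mem_Icc_of_mem_stdSimplex hw k).2)

end Simplex

/-- The cost vector of the linearization of `F_0` at `u`, up to a multiple of `(1, …, 1)`. -/
noncomputable def linearizedCost {K : ℕ} (Ω : Set Plane) (σ lam : ℝ) (f : Plane → Fin K → ℝ)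
    (u : Plane → Fin K → ℝ) (x : Plane) (k : Fin K) : ℝ :=
  f x k - lam * gaussPotential (volume.restrict Ω) σ (fun y => u y k) x

/-! ### Expansion of the energy and optimality conditions. -/

section Energy

variable {K : ℕ} {Ω : Set Plane} {σ lam ε : ℝ} {f u v : Plane → Fin K → ℝ}
  [IsFiniteMeasure (volume.restrict Ω)]

/-- The constraint that the components sum to one collapses the linear part of the nonlocal term to
a constant, which exposes the concave quadratic part. -/
theorem pottsEnergy_eq (hΩ : MeasurableSet Ω) (hf : IntegrableOn f Ω volume)
    (hv : v ∈ simplexFunctions Ω K) :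
    pottsEnergy Ω σ lam f ε v = (∑ k, ∫ x in Ω, v x k * f x k)
      + ε * (∫ x in Ω, ∑ k, v x k * Real.log (v x k))
      + lam / 2 * ((∫ x in Ω, gaussPotential (volume.restrict Ω) σ (fun _ => 1) x)
        - ∑ k, ∫ x in Ω, v x k * gaussPotential (volume.restrict Ω) σ (fun y => v y k) x) := by
  have h1 : Integrable (fun _ : Plane => (1 : ℝ)) (volume.restrict Ω) := integrable_const 1
  have hvk := simplexFunctions.integrable hv
  rw [pottsEnergy, integral_finsetSum _ fun k _ =>
    simplexFunctions.integrable_mul hv k (hf.eval k)]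
  congr 2
  have hB : ∀ k, Integrable (fun x => v x k *
      gaussPotential (volume.restrict Ω) σ (fun y => v y k) x) (volume.restrict Ω) :=
    fun k => integrable_mul_gaussPotential (hvk k) (hvk k)
  rw [← integral_finsetSum _ fun k _ => hB k, ← integral_sub
    (by simpa using integrable_mul_gaussPotential h1 h1) (integrable_finsetSum _ fun k _ => hB k)]
  refine integral_congr_ae ?_
  filter_upwards [hv.2] with x hx
  simp only [gaussConv_eq_gaussPotential hΩ, gaussPotential_sub h1 (hvk _), mul_sub,
    Finset.sum_sub_distrib, ← Finset.sum_mul]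
  rw [hx.2, one_mul]

theorem integrable_linearizedCost (hf : IntegrableOn f Ω volume) (hu : u ∈ simplexFunctions Ω K)
    (k : Fin K) :
    Integrable (fun x => linearizedCost Ω σ lam f u x k) (volume.restrict Ω) := by
  refine (hf.eval k).sub (Integrable.const_mul ?_ lam)
  simpa using integrable_mul_gaussPotential (σ := σ)
    (integrable_const (μ := volume.restrict Ω) (1 : ℝ)) (simplexFunctions.integrable hu k)

/-- `F_ε(v) - F_ε(u)` splits into a pointwise term and a negative definite quadratic term. -/
theorem pottsEnergy_sub (hΩ : MeasurableSet Ω) (hf : IntegrableOn f Ω volume)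
    (hu : u ∈ simplexFunctions Ω K) (hv : v ∈ simplexFunctions Ω K) :
    pottsEnergy Ω σ lam f ε v - pottsEnergy Ω σ lam f ε u
      = (∫ x in Ω, ((∑ k, v x k * linearizedCost Ω σ lam f u x k)
            + ε * ∑ k, v x k * Real.log (v x k))
          - ((∑ k, u x k * linearizedCost Ω σ lam f u x k)
            + ε * ∑ k, u x k * Real.log (u x k)))
        - lam / 2 * ∑ k, ∫ x in Ω, (v x k - u x k)
            * gaussPotential (volume.restrict Ω) σ (fun y => v y k - u y k) x := by
  have hvk := simplexFunctions.integrable hv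
  have huk := simplexFunctions.integrable hu
  have hlin : ∀ w ∈ simplexFunctions Ω K, ∀ k, Integrable
      (fun x => w x k * linearizedCost Ω σ lam f u x k) (volume.restrict Ω) := fun w hw k =>
    simplexFunctions.integrable_mul hw k (integrable_linearizedCost hf hu k)
  have hlin' : ∀ w ∈ simplexFunctions Ω K,
      ∫ x in Ω, (∑ k, w x k * linearizedCost Ω σ lam f u x k)
        + ε * ∑ k, w x k * Real.log (w x k)
      = (∑ k, ((∫ x in Ω, w x k * f x k) - lam * ∫ x in Ω, w x k *
          gaussPotential (volume.restrict Ω) σ (fun y => u y k) x))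
        + ε * ∫ x in Ω, ∑ k, w x k * Real.log (w x k) := by
    intro w hw
    rw [integral_add (integrable_finsetSum _ fun k _ => hlin w hw k)
      ((simplexFunctions.integrable_entropy hw).const_mul _), integral_const_mul,
      integral_finsetSum _ fun k _ => hlin w hw k]
    congr 1
    refine Finset.sum_congr rfl fun k _ => ?_
    rw [← integral_const_mul, ← integral_sub (simplexFunctions.integrable_mul hw k (hf.eval k))
      ((integrable_mul_gaussPotential (simplexFunctions.integrable hw k) (huk k)).const_mul _)]
    refine integral_congr_ae (ae_of_all _ fun x => ?_)
    simp only [linearizedCost]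
    ring
  have hquad : ∀ k, ∫ x in Ω, (v x k - u x k)
        * gaussPotential (volume.restrict Ω) σ (fun y => v y k - u y k) x
      = (∫ x in Ω, v x k * gaussPotential (volume.restrict Ω) σ (fun y => v y k) x)
        - 2 * (∫ x in Ω, v x k * gaussPotential (volume.restrict Ω) σ (fun y => u y k) x)
        + ∫ x in Ω, u x k * gaussPotential (volume.restrict Ω) σ (fun y => u y k) x := by
    intro k
    have hvv := integrable_mul_gaussPotential (σ := σ) (hvk k) (hvk k)
    have hvu := integrable_mul_gaussPotential (σ := σ) (hvk k) (huk k)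
    have huv := integrable_mul_gaussPotential (σ := σ) (huk k) (hvk k)
    have huu := integrable_mul_gaussPotential (σ := σ) (huk k) (huk k)
    have hcomm := integral_mul_gaussPotential_comm (σ := σ) (huk k) (hvk k)
    calc _ = ∫ x in Ω, ((v x k * gaussPotential (volume.restrict Ω) σ (fun y => v y k) x
            - v x k * gaussPotential (volume.restrict Ω) σ (fun y => u y k) x)
          - (u x k * gaussPotential (volume.restrict Ω) σ (fun y => v y k) x
            - u x k * gaussPotential (volume.restrict Ω) σ (fun y => u y k) x)) := by
          refine integral_congr_ae (ae_of_all _ fun x => ?_)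
          simp only [gaussPotential_sub (hvk k) (huk k)]
          ring
      _ = _ := by
          refine (integral_sub (hvv.sub hvu) (huv.sub huu)).trans ?_
          rw [integral_sub' hvv hvu, integral_sub' huv huu, hcomm]
          ring
  have hint : ∀ w ∈ simplexFunctions Ω K, Integrable
      (fun x => (∑ k, w x k * linearizedCost Ω σ lam f u x k)
        + ε * ∑ k, w x k * Real.log (w x k)) (volume.restrict Ω) := fun w hw =>
    (integrable_finsetSum _ fun k _ => hlin w hw k).add
      ((simplexFunctions.integrable_entropy hw).const_mul _)
  rw [integral_sub (hint v hv) (hint u hu), hlin' v hv, hlin' u hu,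
    pottsEnergy_eq hΩ hf hv, pottsEnergy_eq hΩ hf hu]
  simp only [hquad, Finset.sum_sub_distrib, Finset.sum_add_distrib, ← Finset.mul_sum]
  ring

/-- Replacing a minimizer by a vertex of the simplex on a measurable set `A`: the gain in the
linear and entropy terms dominates the quadratic term. -/
theorem IsPottsMinimizer.quadratic_le_setIntegral (hΩ : MeasurableSet Ω)
    (hf : IntegrableOn f Ω volume) (hu : IsPottsMinimizer Ω σ lam f ε u) (i : Fin K)
    {A : Set Plane} (hA : MeasurableSet A) :
    lam / 2 * ∑ k, ∫ x in Ω, A.indicator (fun x => (Pi.single i 1 : Fin K → ℝ) k - u x k) x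
        * gaussPotential (volume.restrict Ω) σ
          (A.indicator fun x => (Pi.single i 1 : Fin K → ℝ) k - u x k) x
      ≤ ∫ x in A, (linearizedCost Ω σ lam f u x i
          - ((∑ k, u x k * linearizedCost Ω σ lam f u x k)
            + ε * ∑ k, u x k * Real.log (u x k))) ∂(volume.restrict Ω) := by
  classical
  have hv := simplexFunctions.piecewise_mem hu.1 (const_single_mem_simplexFunctions Ω i) hA
  have hle := hu.2 hv
  have heq := pottsEnergy_sub (σ := σ) (lam := lam) (ε := ε) hΩ hf hu.1 hv
  have h1 : ∀ k x, A.piecewise (fun _ => Pi.single i 1) u x k - u x k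
      = A.indicator (fun x => (Pi.single i 1 : Fin K → ℝ) k - u x k) x := by
    intro k x
    by_cases hx : x ∈ A <;> simp [hx]
  rw [← integral_indicator hA]
  have h2 : ∀ x, ((∑ k, A.piecewise (fun _ => Pi.single i 1) u x k
          * linearizedCost Ω σ lam f u x k)
        + ε * ∑ k, A.piecewise (fun _ => Pi.single i 1) u x k
          * Real.log (A.piecewise (fun _ => Pi.single i 1) u x k))
      - ((∑ k, u x k * linearizedCost Ω σ lam f u x k)
        + ε * ∑ k, u x k * Real.log (u x k))
      = A.indicator (fun x => linearizedCost Ω σ lam f u x i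
          - ((∑ k, u x k * linearizedCost Ω σ lam f u x k)
            + ε * ∑ k, u x k * Real.log (u x k))) x := by
    intro x
    by_cases hx : x ∈ A
    -- A vertex has zero entropy, so only the entropy of `u` survives on `A`.
    · have : ∑ k, (Pi.single i 1 : Fin K → ℝ) k * Real.log ((Pi.single i 1 : Fin K → ℝ) k)
          = 0 := Finset.sum_eq_zero fun k _ => by
        by_cases hk : k = i
        · subst hk; simp
        · simp [hk]
      simp only [hx, Set.piecewise_eq_of_mem, Set.indicator_of_mem, this]
      simp [Pi.single_apply]
    · simp [hx]
  simp only [h2, h1] at heq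
  have : pottsEnergy Ω σ lam f ε u
      ≤ pottsEnergy Ω σ lam f ε (A.piecewise (fun _ => Pi.single i 1) u) := hle
  linarith

theorem integrable_indicator_single_sub (hu : u ∈ simplexFunctions Ω K) (i k : Fin K)
    {A : Set Plane} (hA : MeasurableSet A) :
    Integrable (A.indicator fun x => (Pi.single i 1 : Fin K → ℝ) k - u x k)
      (volume.restrict Ω) :=
  ((integrable_const _).sub (simplexFunctions.integrable hu k)).indicator hA

theorem integrable_cost_gap (hf : IntegrableOn f Ω volume) (hu : u ∈ simplexFunctions Ω K)
    (i : Fin K) :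
    Integrable (fun x => linearizedCost Ω σ lam f u x i
      - ((∑ k, u x k * linearizedCost Ω σ lam f u x k)
        + ε * ∑ k, u x k * Real.log (u x k))) (volume.restrict Ω) :=
  (integrable_linearizedCost hf hu i).sub ((integrable_finsetSum _ fun k _ =>
    simplexFunctions.integrable_mul hu k (integrable_linearizedCost hf hu k)).add
    ((simplexFunctions.integrable_entropy hu).const_mul _))

/-- A minimizer of `F_ε` minimizes the linearized free energy pointwise, in comparison with the
vertices of the simplex. -/
theorem IsPottsMinimizer.ae_le_linearizedCost (hΩ : MeasurableSet Ω) (hσ : 0 < σ)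
    (hlam : 0 < lam) (hf : IntegrableOn f Ω volume) (hu : IsPottsMinimizer Ω σ lam f ε u) :
    ∀ᵐ x ∂(volume.restrict Ω), ∀ i, (∑ k, u x k * linearizedCost Ω σ lam f u x k)
      + ε * ∑ k, u x k * Real.log (u x k) ≤ linearizedCost Ω σ lam f u x i := by
  rw [ae_all_iff]
  intro i
  -- The quadratic form is nonnegative, so the cost gap has nonnegative integral over every
  -- measurable set.
  have := ae_nonneg_of_forall_setIntegral_nonneg
    (integrable_cost_gap (σ := σ) (lam := lam) (ε := ε) hf hu.1 i) fun A hA _ =>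
      le_trans ?_ (hu.quadratic_le_setIntegral hΩ hf i hA)
  · filter_upwards [this] with x hx
    exact sub_nonneg.1 hx
  · exact mul_nonneg (by positivity) (Finset.sum_nonneg fun k _ =>
      integral_mul_gaussPotential_self_nonneg hσ (integrable_indicator_single_sub hu.1 i k hA))

/-- For a minimizer of `F_0`, every index of minimal cost carries the full mass. -/
theorem IsPottsMinimizer.ae_eq_one (hΩ : MeasurableSet Ω) (hσ : 0 < σ)
    (hlam : 0 < lam) (hf : IntegrableOn f Ω volume) (hu : IsPottsMinimizer Ω σ lam f 0 u) :
    ∀ᵐ x ∂(volume.restrict Ω), ∀ i,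
      (∀ j, linearizedCost Ω σ lam f u x i ≤ linearizedCost Ω σ lam f u x j) → u x i = 1 := by
  rw [ae_all_iff]
  intro i
  have hgap := integrable_cost_gap (σ := σ) (lam := lam) (ε := 0) hf hu.1 i
  set d := fun x => linearizedCost Ω σ lam f u x i
      - ((∑ k, u x k * linearizedCost Ω σ lam f u x k)
        + 0 * ∑ k, u x k * Real.log (u x k)) with hd
  -- The set where the vertex `e_i` costs no more than `u`. A strongly measurable representative of
  -- the gap is used so that `A` is measurable.
  set A : Set Plane := {x | hgap.1.mk d x ≤ 0}
  have hA : MeasurableSet A :=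
    measurableSet_le hgap.1.stronglyMeasurable_mk.measurable measurable_const
  have hle := hu.quadratic_le_setIntegral hΩ hf i hA
  have hdA : ∫ x in A, d x ∂(volume.restrict Ω) ≤ 0 := by
    refine setIntegral_nonpos_ae hA ?_
    filter_upwards [hgap.1.ae_eq_mk] with x hx hxA
    rw [hx]
    exact hxA
  have hnn : ∀ k, 0 ≤ ∫ x in Ω, A.indicator (fun x => (Pi.single i 1 : Fin K → ℝ) k - u x k) x
        * gaussPotential (volume.restrict Ω) σ
          (A.indicator fun x => (Pi.single i 1 : Fin K → ℝ) k - u x k) x := fun k =>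
    integral_mul_gaussPotential_self_nonneg hσ (integrable_indicator_single_sub hu.1 i k hA)
  have hsum := Finset.single_le_sum (fun k _ => hnn k) (Finset.mem_univ i)
  -- The sum of nonnegative forms is at most zero, hence so is its `i`-th term, and `u_i = 1` almost
  -- everywhere on `A`.
  have hi := ae_eq_zero_of_integral_mul_gaussPotential_self_nonpos hσ
    (integrable_indicator_single_sub hu.1 i i hA) (by nlinarith [hle.trans hdA])
  filter_upwards [hi, hgap.1.ae_eq_mk, hu.1.2] with x hx hmk hsx hmin
  -- A convex combination of the costs is at least the minimal cost, so points where `i` is minimal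
  -- lie in `A`.
  have hxA : x ∈ A := by
    change hgap.1.mk d x ≤ 0
    rw [← hmk, hd]
    have : ∑ k, u x k * linearizedCost Ω σ lam f u x i
        ≤ ∑ k, u x k * linearizedCost Ω σ lam f u x k :=
      Finset.sum_le_sum fun k _ => mul_le_mul_of_nonneg_left (hmin k) (hsx.1 k)
    rw [← Finset.sum_mul, hsx.2, one_mul] at this
    simpa using this
  simp only [hxA, Set.indicator_of_mem, Pi.single_eq_same, Pi.zero_apply] at hx
  linarith

theorem exists_forall_le_of_mem_stdSimplex {w : Fin K → ℝ} (hw : w ∈ stdSimplex ℝ (Fin K))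
    (g : Fin K → ℝ) : ∃ i, ∀ j, g i ≤ g j := by
  have : Nonempty (Fin K) := by
    by_contra hK
    rw [not_nonempty_iff] at hK
    simpa using hw.2
  exact Finite.exists_min g

theorem eq_zero_of_eq_one_of_mem_stdSimplex {w : Fin K → ℝ} (hw : w ∈ stdSimplex ℝ (Fin K))
    {i k : Fin K} (hi : w i = 1) (hk : k ≠ i) : w k = 0 := by
  have h := hw.2
  rw [← Finset.add_sum_erase _ _ (Finset.mem_univ i), hi] at h
  refine (Finset.sum_eq_zero_iff_of_nonneg fun j _ => hw.1 j).1 (by linarith) k ?_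
  simp [hk]

theorem IsPottsMinimizer.ae_mem_binaryVectors (hΩ : MeasurableSet Ω) (hσ : 0 < σ)
    (hlam : 0 < lam) (hf : IntegrableOn f Ω volume) (hu : IsPottsMinimizer Ω σ lam f 0 u) :
    ∀ᵐ x ∂(volume.restrict Ω), u x ∈ binaryVectors K := by
  filter_upwards [hu.ae_eq_one hΩ hσ hlam hf, hu.1.2] with x hx hsx k
  obtain ⟨i, hi⟩ := exists_forall_le_of_mem_stdSimplex hsx (linearizedCost Ω σ lam f u x)
  by_cases hk : k = i
  · exact Or.inr (hk ▸ hx i hi)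
  · exact Or.inl (eq_zero_of_eq_one_of_mem_stdSimplex hsx (hx i hi) hk)

end Energy

/-! ### From convergence on sets to convergence against integrable functions. -/

section WeakConvergence

variable {α : Type*} [MeasurableSpace α] {μ : Measure α}

/-- Convergence of the integrals over measurable sets implies, for uniformly bounded sequences,
convergence of the integrals against every integrable function. -/
theorem tendsto_integral_mul_of_tendsto_setIntegral [IsFiniteMeasure μ] {w : ℕ → α → ℝ}
    {v : α → ℝ} {C : NNReal} (hwm : ∀ n, AEStronglyMeasurable (w n) μ)
    (hw : ∀ n, ∀ᵐ x ∂μ, ‖w n x‖ ≤ C)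
    (hvm : AEStronglyMeasurable v μ) (hv : ∀ᵐ x ∂μ, ‖v x‖ ≤ C)
    (h : ∀ A, MeasurableSet A → Tendsto (fun n => ∫ x in A, w n x ∂μ) atTop (𝓝 (∫ x in A, v x ∂μ)))
    {φ : α → ℝ} (hφ : Integrable φ μ) :
    Tendsto (fun n => ∫ x, w n x * φ x ∂μ) atTop (𝓝 (∫ x, v x * φ x ∂μ)) := by
  -- All the functionals share the Lipschitz constant `C` on `L¹`. This equicontinuity makes the set
  -- of good test functions closed, so indicators and sums suffice.
  have hlip : ∀ g : α → ℝ, AEStronglyMeasurable g μ → (∀ᵐ x ∂μ, ‖g x‖ ≤ C) →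
      LipschitzWith C (fun φ : Lp ℝ 1 μ => ∫ x, g x * φ x ∂μ) := by
    intro g hgm hg
    refine LipschitzWith.of_dist_le_mul fun φ ψ => ?_
    rw [dist_eq_norm, ← integral_sub ((L1.integrable_coeFn φ).bdd_mul hgm hg)
      ((L1.integrable_coeFn ψ).bdd_mul hgm hg), dist_eq_norm, L1.norm_eq_integral_norm,
      ← integral_const_mul]
    refine norm_integral_le_of_norm_le ((L1.integrable_coeFn (φ - ψ)).norm.const_mul _) ?_
    filter_upwards [hg, Lp.coeFn_sub φ ψ] with x hx hsub
    rw [hsub, Pi.sub_apply, ← mul_sub, norm_mul]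
    gcongr
  refine Integrable.induction (fun φ : α → ℝ => Tendsto (fun n => ∫ x, w n x * φ x ∂μ) atTop
    (𝓝 (∫ x, v x * φ x ∂μ))) ?_ ?_ ?_ ?_ hφ
  · intro c s hs _
    have key : ∀ g : α → ℝ, ∫ x, g x * s.indicator (fun _ => c) x ∂μ
        = (∫ x in s, g x ∂μ) * c := by
      intro g
      rw [← integral_indicator hs, ← integral_mul_const]
      refine integral_congr_ae (ae_of_all _ fun x => ?_)
      by_cases hx : x ∈ s <;> simp [hx]
    simp only [key]
    exact (h _ hs).mul_const c
  · intro p q _ hp hq ihp ihq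
    have key : ∀ g : α → ℝ, AEStronglyMeasurable g μ → (∀ᵐ x ∂μ, ‖g x‖ ≤ C) →
        ∫ x, g x * (p + q) x ∂μ = (∫ x, g x * p x ∂μ) + ∫ x, g x * q x ∂μ := by
      intro g hgm hg
      rw [← integral_add (hp.bdd_mul hgm hg) (hq.bdd_mul hgm hg)]
      simp only [Pi.add_apply, mul_add]
    rw [key v hvm hv]
    simp only [fun n => key (w n) (hwm n) (hw n)]
    exact ihp.add ihq
  · exact Equicontinuous.isClosed_setOfPred_tendsto (LipschitzWith.uniformEquicontinuous _ C
      fun n => hlip (w n) (hwm n) (hw n)).equicontinuous (hlip v hvm hv).continuous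
  · intro p q hpq _ ih
    have key : ∀ g : α → ℝ, ∫ x, g x * p x ∂μ = ∫ x, g x * q x ∂μ := fun g =>
      integral_congr_ae (hpq.mono fun x hx => by simp only [hx])
    simpa only [key] using ih

end WeakConvergence

/-! ### Passage to the limit along weakly convergent minimizers. -/

section Limit

variable {K : ℕ} {Ω : Set Plane} {σ lam : ℝ} {f v : Plane → Fin K → ℝ} {ε : ℕ → ℝ}
  {u : ℕ → Plane → Fin K → ℝ} [IsFiniteMeasure (volume.restrict Ω)]

/-- The simplex constraints are linear, so they can be tested by integrals over measurable sets,
which pass to the limit. -/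
theorem mem_simplexFunctions_of_tendsto_setIntegral (hu : ∀ n, u n ∈ simplexFunctions Ω K)
    (hv : IntegrableOn v Ω volume)
    (h : ∀ k A, MeasurableSet A → Tendsto (fun n => ∫ x in A, u n x k ∂(volume.restrict Ω)) atTop
      (𝓝 (∫ x in A, v x k ∂(volume.restrict Ω)))) :
    v ∈ simplexFunctions Ω K := by
  have hvk := fun k => hv.eval k
  have hnn : ∀ k, ∀ᵐ x ∂(volume.restrict Ω), 0 ≤ v x k := fun k =>
    ae_nonneg_of_forall_setIntegral_nonneg (hvk k) fun A hA _ =>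
      ge_of_tendsto' (h k A hA) fun n => setIntegral_nonneg_of_ae
        ((simplexFunctions.ae_mem_Icc (hu n)).mono fun x hx => (hx k).1)
  have hsum : (fun x => ∑ k, v x k) =ᵐ[volume.restrict Ω] fun _ => 1 := by
    refine Integrable.ae_eq_of_forall_setIntegral_eq _ _
      (integrable_finsetSum _ fun k _ => hvk k) (integrable_const 1) fun A hA _ => ?_
    refine tendsto_nhds_unique (f := fun n => ∑ k, ∫ x in A, u n x k ∂(volume.restrict Ω))
      (l := atTop) ?_ (tendsto_const_nhds.congr fun n => ?_)
    · rw [integral_finsetSum _ fun k _ => (hvk k).integrableOn]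
      exact tendsto_finsetSum _ fun k _ => h k A hA
    · rw [← integral_finsetSum _ fun k _ => (simplexFunctions.integrable (hu n) k).integrableOn]
      refine integral_congr_ae (ae_restrict_of_ae ?_)
      filter_upwards [(hu n).2] with x hx using hx.2.symm
  refine ⟨hv.1, ?_⟩
  filter_upwards [ae_all_iff.2 hnn, hsum] with x h1 h2 using ⟨h1, h2⟩

theorem tendsto_integral_simplexFunctions_mul (hu : ∀ n, u n ∈ simplexFunctions Ω K)
    (hv : v ∈ simplexFunctions Ω K)
    (h : ∀ k A, MeasurableSet A → Tendsto (fun n => ∫ x in A, u n x k ∂(volume.restrict Ω)) atTop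
      (𝓝 (∫ x in A, v x k ∂(volume.restrict Ω)))) (k : Fin K) {φ : Plane → ℝ}
    (hφ : Integrable φ (volume.restrict Ω)) :
    Tendsto (fun n => ∫ x in Ω, u n x k * φ x) atTop (𝓝 (∫ x in Ω, v x k * φ x)) :=
  tendsto_integral_mul_of_tendsto_setIntegral (C := 1)
    (fun n => simplexFunctions.aestronglyMeasurable (hu n) k)
    (fun n => by simpa using simplexFunctions.ae_norm_le_one (hu n) k)
    (simplexFunctions.aestronglyMeasurable hv k)
    (by simpa using simplexFunctions.ae_norm_le_one hv k) (h k) hφ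

/-- For fixed `x` the kernel `y ↦ G_σ(x - y)` is a single integrable test function, so weak
convergence becomes pointwise convergence. -/
theorem tendsto_gaussPotential (hu : ∀ n, u n ∈ simplexFunctions Ω K)
    (hv : v ∈ simplexFunctions Ω K)
    (h : ∀ k A, MeasurableSet A → Tendsto (fun n => ∫ x in A, u n x k ∂(volume.restrict Ω)) atTop
      (𝓝 (∫ x in A, v x k ∂(volume.restrict Ω)))) (k : Fin K) (x : Plane) :
    Tendsto (fun n => gaussPotential (volume.restrict Ω) σ (fun y => u n y k) x) atTop
      (𝓝 (gaussPotential (volume.restrict Ω) σ (fun y => v y k) x)) :=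
  tendsto_integral_simplexFunctions_mul hu hv h k
    (by
      simpa using integrable_mul_gaussKernel (σ := σ)
        (integrable_const (μ := volume.restrict Ω) (1 : ℝ)) x)

/-- Both factors vary, and weak convergence alone does not control products. Write `G * u_n = G * v
+ G * (u_n - v)`: the first part is a fixed test function, and the second tends to zero pointwise
and boundedly, so its product with the bounded `u_n` integrates to something vanishing. -/
theorem tendsto_integral_mul_gaussPotential (hu : ∀ n, u n ∈ simplexFunctions Ω K)
    (hv : v ∈ simplexFunctions Ω K)
    (h : ∀ k A, MeasurableSet A → Tendsto (fun n => ∫ x in A, u n x k ∂(volume.restrict Ω)) atTop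
      (𝓝 (∫ x in A, v x k ∂(volume.restrict Ω)))) (k : Fin K) :
    Tendsto (fun n => ∫ x in Ω, u n x k
        * gaussPotential (volume.restrict Ω) σ (fun y => u n y k) x) atTop
      (𝓝 (∫ x in Ω, v x k * gaussPotential (volume.restrict Ω) σ (fun y => v y k) x)) := by
  have huk := fun n => simplexFunctions.integrable (hu n) k
  have hvk := simplexFunctions.integrable hv k
  have hgv : Integrable (gaussPotential (volume.restrict Ω) σ fun y => v y k)
      (volume.restrict Ω) := by
    simpa using integrable_mul_gaussPotential (σ := σ)
      (integrable_const (μ := volume.restrict Ω) (1 : ℝ)) hvk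
  have h1 := tendsto_integral_simplexFunctions_mul hu hv h k hgv
  have h2 : Tendsto (fun n => ∫ x in Ω, u n x k
      * gaussPotential (volume.restrict Ω) σ (fun y => u n y k - v y k) x) atTop (𝓝 0) := by
    -- A mass bound independent of `n`, which supplies the constant dominating function.
    have hmass : ∀ n, ∫ y in Ω, ‖u n y k - v y k‖ ≤ ∫ _ in Ω, (2 : ℝ) := fun n => by
      refine integral_mono_ae ((huk n).sub hvk).norm (integrable_const _) ?_
      filter_upwards [simplexFunctions.ae_norm_le_one (hu n) k,
        simplexFunctions.ae_norm_le_one hv k] with y h1 h2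
      exact (norm_sub_le _ _).trans (by linarith)
    rw [← integral_zero Plane ℝ (μ := volume.restrict Ω)]
    refine tendsto_integral_of_dominated_convergence
      (fun _ => (∫ _ in Ω, (2 : ℝ)) * (1 / (2 * Real.pi * σ ^ 2)))
      (fun n => (integrable_mul_gaussPotential (huk n) ((huk n).sub hvk)).1)
      (integrable_const _) (fun n => ?_) ?_
    · filter_upwards [simplexFunctions.ae_norm_le_one (hu n) k] with x hx
      rw [norm_mul]
      refine (mul_le_of_le_one_left (norm_nonneg _) hx).trans
        ((abs_gaussPotential_le ((huk n).sub hvk) x).trans ?_)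
      exact mul_le_mul_of_nonneg_right (hmass n) (by positivity)
    · filter_upwards [ae_all_iff.2 fun n => simplexFunctions.ae_norm_le_one (hu n) k] with x hx
      refine squeeze_zero_norm (fun n => ?_) (a := fun n =>
        ‖gaussPotential (volume.restrict Ω) σ (fun y => u n y k) x
          - gaussPotential (volume.restrict Ω) σ (fun y => v y k) x‖) ?_
      · rw [norm_mul, gaussPotential_sub (huk n) hvk]
        exact mul_le_of_le_one_left (norm_nonneg _) (hx n)
      · have := ((tendsto_gaussPotential (σ := σ) hu hv h k x).sub_const
          (gaussPotential (volume.restrict Ω) σ (fun y => v y k) x)).norm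
        simpa using this
  have h3 := h1.add h2
  rw [add_zero] at h3
  refine h3.congr fun n => ?_
  refine (integral_add (simplexFunctions.integrable_mul (hu n) k hgv)
    (integrable_mul_gaussPotential (σ := σ) (huk n) ((huk n).sub hvk))).symm.trans ?_
  refine integral_congr_ae (ae_of_all _ fun x => ?_)
  have := gaussPotential_sub (σ := σ) (huk n) hvk x
  simp only [Pi.sub_def, this]
  ring

theorem tendsto_pottsEnergy_zero (hΩ : MeasurableSet Ω) (hf : IntegrableOn f Ω volume)
    (hu : ∀ n, u n ∈ simplexFunctions Ω K) (hv : v ∈ simplexFunctions Ω K)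
    (h : ∀ k A, MeasurableSet A → Tendsto (fun n => ∫ x in A, u n x k ∂(volume.restrict Ω)) atTop
      (𝓝 (∫ x in A, v x k ∂(volume.restrict Ω)))) :
    Tendsto (fun n => pottsEnergy Ω σ lam f 0 (u n)) atTop (𝓝 (pottsEnergy Ω σ lam f 0 v)) := by
  simp only [fun n => pottsEnergy_eq (σ := σ) (lam := lam) (ε := 0) hΩ hf (hu n),
    pottsEnergy_eq (σ := σ) (lam := lam) (ε := 0) hΩ hf hv, zero_mul, add_zero]
  exact (tendsto_finsetSum _ fun k _ =>
    tendsto_integral_simplexFunctions_mul hu hv h k (hf.eval k)).add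
    ((tendsto_const_nhds.sub (tendsto_finsetSum _ fun k _ =>
      tendsto_integral_mul_gaussPotential hu hv h k)).const_mul _)

theorem pottsEnergy_eq_add_entropy (Ω : Set Plane) (σ lam : ℝ) (f : Plane → Fin K → ℝ) (ε : ℝ)
    (v : Plane → Fin K → ℝ) : pottsEnergy Ω σ lam f ε v = pottsEnergy Ω σ lam f 0 v
      + ε * ∫ x in Ω, ∑ k, v x k * Real.log (v x k) := by
  simp only [pottsEnergy]
  ring

theorem abs_integral_entropy_le (hv : v ∈ simplexFunctions Ω K) :
    |∫ x in Ω, ∑ k, v x k * Real.log (v x k)| ≤ ∫ _ in Ω, (K : ℝ) := by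
  rw [← Real.norm_eq_abs]
  refine norm_integral_le_of_norm_le (integrable_const _) ?_
  filter_upwards [hv.2] with x hx
  exact abs_le.2 ⟨neg_card_le_entropy hx, (entropy_nonpos hx).trans (Nat.cast_nonneg K)⟩

/-- Weak limits of minimizers of `F_{ε n}`, `ε n → 0`, minimize `F_0`. -/
theorem isPottsMinimizer_of_tendsto_setIntegral (hΩ : MeasurableSet Ω)
    (hf : IntegrableOn f Ω volume) (hε : Tendsto ε atTop (𝓝 0))
    (hu : ∀ n, IsPottsMinimizer Ω σ lam f (ε n) (u n)) (hv : v ∈ simplexFunctions Ω K)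
    (h : ∀ k A, MeasurableSet A → Tendsto (fun n => ∫ x in A, u n x k ∂(volume.restrict Ω)) atTop
      (𝓝 (∫ x in A, v x k ∂(volume.restrict Ω)))) :
    IsPottsMinimizer Ω σ lam f 0 v := by
  refine ⟨hv, fun w hw => ?_⟩
  have h1 : Tendsto (fun n => pottsEnergy Ω σ lam f (ε n) (u n)) atTop
      (𝓝 (pottsEnergy Ω σ lam f 0 v)) := by
    -- The entropy integral is bounded uniformly over admissible functions, so the factor `ε n`
    -- kills it even though `u n` varies.
    have h0 : Tendsto (fun n => ε n * ∫ x in Ω, ∑ k, u n x k * Real.log (u n x k)) atTop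
        (𝓝 0) := by
      refine squeeze_zero_norm (a := fun n => ‖ε n‖ * ∫ _ in Ω, (K : ℝ)) (fun n => ?_) ?_
      · rw [norm_mul]
        exact mul_le_mul_of_nonneg_left (abs_integral_entropy_le (hu n).1) (norm_nonneg _)
      · simpa using hε.norm.mul_const (∫ _ in Ω, (K : ℝ))
    have := (tendsto_pottsEnergy_zero (σ := σ) (lam := lam) hΩ hf (fun n => (hu n).1) hv h).add h0
    rw [add_zero] at this
    exact this.congr fun n => (pottsEnergy_eq_add_entropy ..).symm
  have h2 : Tendsto (fun n => pottsEnergy Ω σ lam f (ε n) w) atTop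
      (𝓝 (pottsEnergy Ω σ lam f 0 w)) := by
    have := (tendsto_const_nhds (x := pottsEnergy Ω σ lam f 0 w)).add
      (hε.mul_const (∫ x in Ω, ∑ k, w x k * Real.log (w x k)))
    rw [zero_mul, add_zero] at this
    exact this.congr fun n => (pottsEnergy_eq_add_entropy ..).symm
  exact le_of_tendsto_of_tendsto' h1 h2 fun n => (hu n).2 hw

/-- Approximate minimizers of linear functions on the simplex converge to a vertex, if the limit
function has a unique minimal index. -/
theorem tendsto_of_linear_le {w g : ℕ → Fin K → ℝ} {w' g' : Fin K → ℝ} {e : ℕ → ℝ}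
    (hw : ∀ n, w n ∈ stdSimplex ℝ (Fin K)) (hw' : w' ∈ stdSimplex ℝ (Fin K))
    (he : Tendsto e atTop (𝓝 0)) (hg : ∀ k, Tendsto (fun n => g n k) atTop (𝓝 (g' k)))
    (hle : ∀ n i, ∑ k, w n k * g n k ≤ g n i + e n)
    (hone : ∀ i, (∀ j, g' i ≤ g' j) → w' i = 1) : Tendsto w atTop (𝓝 w') := by
  obtain ⟨i, hi⟩ := exists_forall_le_of_mem_stdSimplex hw' g'
  have hi1 := hone i hi
  have hoff : ∀ k, k ≠ i → w' k = 0 := fun k hk =>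
    eq_zero_of_eq_one_of_mem_stdSimplex hw' hi1 hk
  -- Two minimal indices would both carry mass one, so `hone` makes the minimal index unique.
  have hlt : ∀ k, k ≠ i → g' i < g' k := by
    intro k hk
    by_contra hcon
    have := hone k fun j => (not_lt.1 hcon).trans (hi j)
    rw [hoff k hk] at this
    exact zero_ne_one this
  have hzero : ∀ k, k ≠ i → Tendsto (fun n => w n k) atTop (𝓝 0) := by
    intro k hk
    have hpos : ∀ᶠ n in atTop, ∀ j, 0 ≤ g n j - g n i := by
      refine eventually_all.2 fun j => ?_
      by_cases hj : j = i
      · subst hj; simp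
      · filter_upwards [((hg j).sub (hg i)).eventually (lt_mem_nhds (sub_pos.2 (hlt j hj)))]
          with n hn using hn.le
    -- Half the limiting gap is eventually a lower bound for the actual gap. The mass at `k` is then
    -- at most the error divided by this half-gap.
    have hgap : ∀ᶠ n in atTop, (g' k - g' i) / 2 < g n k - g n i :=
      ((hg k).sub (hg i)).eventually (lt_mem_nhds (half_lt_self (sub_pos.2 (hlt k hk))))
    have hlim : Tendsto (fun n => e n / ((g' k - g' i) / 2)) atTop (𝓝 0) := by
      simpa using he.div_const ((g' k - g' i) / 2)
    refine tendsto_of_tendsto_of_tendsto_of_le_of_le' tendsto_const_nhds hlim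
      (Eventually.of_forall fun n => (hw n).1 k) ?_
    filter_upwards [hpos, hgap] with n hn1 hn2
    rw [le_div_iff₀ (half_pos (sub_pos.2 (hlt k hk)))]
    calc w n k * ((g' k - g' i) / 2) ≤ w n k * (g n k - g n i) :=
          mul_le_mul_of_nonneg_left hn2.le ((hw n).1 k)
      _ ≤ ∑ j, w n j * (g n j - g n i) := Finset.single_le_sum
          (f := fun j => w n j * (g n j - g n i))
          (fun j _ => mul_nonneg ((hw n).1 j) (hn1 j)) (Finset.mem_univ k)
      _ = (∑ j, w n j * g n j) - g n i := by
          simp only [mul_sub, Finset.sum_sub_distrib]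
          rw [← Finset.sum_mul, (hw n).2, one_mul]
      _ ≤ e n := by linarith [hle n i]
  have hone' : Tendsto (fun n => w n i) atTop (𝓝 1) := by
    have := (tendsto_const_nhds (x := (1 : ℝ))).sub (tendsto_finsetSum (Finset.univ.erase i)
      fun k hk => hzero k (Finset.ne_of_mem_erase hk))
    rw [Finset.sum_const_zero, sub_zero] at this
    refine this.congr fun n => ?_
    rw [← (hw n).2, ← Finset.add_sum_erase _ _ (Finset.mem_univ i), add_sub_cancel_right]
  refine tendsto_pi_nhds.2 fun k => ?_
  by_cases hk : k = i
  · subst hk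
    rwa [hi1]
  · rw [hoff k hk]
    exact hzero k hk

/-- Since the entropy is at least `-K`, the pointwise optimality of `u n` is linear optimality up to
`ε n * K`. The linearized costs converge pointwise, and the limit, a minimizer of `F_0`, supplies
the uniqueness required by `tendsto_of_linear_le`. -/
theorem ae_tendsto_of_tendsto_setIntegral (hΩ : MeasurableSet Ω) (hσ : 0 < σ) (hlam : 0 < lam)
    (hf : IntegrableOn f Ω volume) (hε0 : ∀ n, 0 < ε n) (hε : Tendsto ε atTop (𝓝 0))
    (hu : ∀ n, IsPottsMinimizer Ω σ lam f (ε n) (u n)) (hv : v ∈ simplexFunctions Ω K)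
    (h : ∀ k A, MeasurableSet A → Tendsto (fun n => ∫ x in A, u n x k ∂(volume.restrict Ω)) atTop
      (𝓝 (∫ x in A, v x k ∂(volume.restrict Ω)))) :
    ∀ᵐ x ∂(volume.restrict Ω), Tendsto (fun n => u n x) atTop (𝓝 (v x)) := by
  have hmin := isPottsMinimizer_of_tendsto_setIntegral hΩ hf hε hu hv h
  filter_upwards [hmin.ae_eq_one hΩ hσ hlam hf, hv.2, ae_all_iff.2 fun n => (hu n).1.2,
    ae_all_iff.2 fun n => (hu n).ae_le_linearizedCost hΩ hσ hlam hf] with x hone hvx hux hle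
  refine tendsto_of_linear_le (g := fun n => linearizedCost Ω σ lam f (u n) x)
    (e := fun n => ε n * K) hux hvx (by simpa using hε.mul_const (K : ℝ)) (fun k => ?_)
    (fun n i => ?_) hone
  · exact tendsto_const_nhds.sub
      ((tendsto_gaussPotential (fun n => (hu n).1) hv h k x).const_mul lam)
  · have h1 := hle n i
    have h2 := mul_le_mul_of_nonneg_left (neg_card_le_entropy (hux n)) (hε0 n).le
    linarith

end Limit

/-! ### Weak sequential compactness of bounded sequences. -/

/-- A uniformly bounded sequence of vector-valued functions on a finite measure space has a
subsequence whose integrals over all measurable sets converge to those of an integrable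
function. -/
theorem exists_subseq_tendsto_setIntegral {α : Type*} [MeasurableSpace α]
    [MeasurableSpace.CountablyGenerated α] {μ : Measure α} [IsFiniteMeasure μ] {K : ℕ}
    {u : ℕ → α → Fin K → ℝ} (hum : ∀ n, AEStronglyMeasurable (u n) μ) {C : ℝ}
    (hu : ∀ n, ∀ᵐ x ∂μ, ‖u n x‖ ≤ C) :
    ∃ (φ : ℕ → ℕ) (v : α → Fin K → ℝ), StrictMono φ ∧ Integrable v μ ∧
      ∀ k A, MeasurableSet A →
        Tendsto (fun n => ∫ x in A, u (φ n) x k ∂μ) atTop (𝓝 (∫ x in A, v x k ∂μ)) := by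
  -- The Euclidean norm on the values makes `L²` a Hilbert space, so the Riesz representation is
  -- available.
  let E := EuclideanSpace ℝ (Fin K)
  let L : (Fin K → ℝ) ≃L[ℝ] E := (EuclideanSpace.equiv (Fin K) ℝ).symm
  have hbd : ∀ n, ∀ᵐ x ∂μ, ‖L (u n x)‖ ≤ ‖(L : (Fin K → ℝ) →L[ℝ] E)‖ * C := fun n =>
    (hu n).mono fun x hx => ((L : (Fin K → ℝ) →L[ℝ] E).le_opNorm _).trans
      (mul_le_mul_of_nonneg_left hx (norm_nonneg _))
  have hmem : ∀ n, MemLp (fun x => L (u n x)) 2 μ := fun n =>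
    MemLp.of_bound (L.continuous.comp_aestronglyMeasurable (hum n)) _ (hbd n)
  let U : ℕ → Lp E 2 μ := fun n => (hmem n).toLp
  obtain ⟨R, hR⟩ : ∃ R, ∀ n, ‖U n‖ ≤ R := by
    refine ⟨_, fun n => Lp.norm_le_of_ae_bound
      (C := max (‖(L : (Fin K → ℝ) →L[ℝ] E)‖ * C) 0) (le_max_right _ _) ?_⟩
    filter_upwards [hbd n, (hmem n).coeFn_toLp] with x hx hx'
    rw [hx']
    exact hx.trans (le_max_left _ _)
  have : Fact ((1 : ENNReal) ≤ 2) := ⟨one_le_two⟩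
  have : Fact ((2 : ENNReal) ≠ ⊤) := ⟨ENNReal.ofNat_ne_top⟩
  -- Sequential Banach–Alaoglu. The countably generated σ-algebra makes `L²` separable, which is
  -- what gives sequences rather than nets.
  obtain ⟨ℓ, -, φ, hφ, hlim⟩ := WeakDual.isSeqCompact_closedBall ℝ (Lp E 2 μ) 0 R
    (x := fun n => StrongDual.toWeakDual (InnerProductSpace.toDual ℝ (Lp E 2 μ) (U n)))
    (fun n => by simpa using hR n)
  let V : Lp E 2 μ := (InnerProductSpace.toDual ℝ (Lp E 2 μ)).symm (WeakDual.toStrongDual ℓ)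
  have hVint : Integrable V μ := (Lp.memLp V).integrable one_le_two
  -- Pairing with the indicator of `A` times the `k`-th basis vector recovers the integral of the
  -- `k`-th component over `A`.
  have hset : ∀ (W : Lp E 2 μ) (w : α → Fin K → ℝ), (∀ᵐ x ∂μ, W x = L (w x)) → ∀ k A,
      ∀ hA : MeasurableSet A, inner ℝ W (indicatorConstLp 2 hA (measure_ne_top μ A)
        (EuclideanSpace.single k (1 : ℝ))) = ∫ x in A, w x k ∂μ := by
    intro W w hW k A hA
    rw [real_inner_comm, L2.inner_indicatorConstLp_eq_setIntegral_inner]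
    refine integral_congr_ae (ae_restrict_of_ae ?_)
    filter_upwards [hW] with x hx
    rw [hx]
    exact (EuclideanSpace.inner_single_left k (1 : ℝ) _).trans (by simp only [map_one, one_mul]; rfl)
  refine ⟨φ, fun x => L.symm (V x), hφ, L.symm.integrable_comp_iff.2 hVint, fun k A hA => ?_⟩
  rw [← hset V _ (ae_of_all _ fun x => (L.apply_symm_apply _).symm) k A hA]
  simp only [← fun n => hset (U n) (u n) (hmem n).coeFn_toLp k A hA]
  have h1 := ((WeakDual.eval_continuous (𝕜 := ℝ) (indicatorConstLp 2 hA (measure_ne_top μ A)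
    (EuclideanSpace.single k (1 : ℝ) : E))).tendsto ℓ).comp hlim
  have h2 : inner ℝ V (indicatorConstLp 2 hA (measure_ne_top μ A)
      (EuclideanSpace.single k (1 : ℝ) : E)) = ℓ (indicatorConstLp 2 hA (measure_ne_top μ A)
      (EuclideanSpace.single k (1 : ℝ) : E)) := by
    rw [← InnerProductSpace.toDual_apply_apply, LinearIsometryEquiv.apply_symm_apply]
    rfl
  rw [h2]
  exact h1

/-! ### Binary limits and convergence in measure. -/

section Binary

variable {K : ℕ} {Ω : Set Plane} {σ lam : ℝ} {f : Plane → Fin K → ℝ} {ε : ℕ → ℝ}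
  {u : ℕ → Plane → Fin K → ℝ} [IsFiniteMeasure (volume.restrict Ω)]

theorem exists_subseq_ae_tendsto (hΩ : MeasurableSet Ω) (hσ : 0 < σ) (hlam : 0 < lam)
    (hf : IntegrableOn f Ω volume) (hε0 : ∀ n, 0 < ε n) (hε : Tendsto ε atTop (𝓝 0))
    (hu : ∀ n, IsPottsMinimizer Ω σ lam f (ε n) (u n)) :
    ∃ (φ : ℕ → ℕ) (v : Plane → Fin K → ℝ), StrictMono φ ∧ IsPottsMinimizer Ω σ lam f 0 v ∧
      (∀ᵐ x ∂(volume.restrict Ω), v x ∈ binaryVectors K) ∧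
      ∀ᵐ x ∂(volume.restrict Ω), Tendsto (fun n => u (φ n) x) atTop (𝓝 (v x)) := by
  obtain ⟨φ, v, hφ, hvint, hlim⟩ := exists_subseq_tendsto_setIntegral (C := 1)
    (fun n => (hu n).1.1) fun n => by
      filter_upwards [ae_all_iff.2 (simplexFunctions.ae_norm_le_one (hu n).1)] with x hx
      exact (pi_norm_le_iff_of_nonneg zero_le_one).2 hx
  have hv := mem_simplexFunctions_of_tendsto_setIntegral (fun n => (hu (φ n)).1) hvint hlim
  have hε' := hε.comp hφ.tendsto_atTop
  have hmin := isPottsMinimizer_of_tendsto_setIntegral hΩ hf hε' (fun n => hu (φ n)) hv hlim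
  exact ⟨φ, v, hφ, hmin, hmin.ae_mem_binaryVectors hΩ hσ hlam hf,
    ae_tendsto_of_tendsto_setIntegral hΩ hσ hlam hf (fun n => hε0 (φ n)) hε'
      (fun n => hu (φ n)) hv hlim⟩

/-- On a finite measure space, almost everywhere convergence implies convergence in measure, and the
distance to the binary vectors is at most the distance to the binary limit. -/
theorem tendsto_measure_infDist_binaryVectors {v : Plane → Fin K → ℝ} (hΩ : MeasurableSet Ω)
    (hu : ∀ n, AEStronglyMeasurable (u n) (volume.restrict Ω))
    (hv : ∀ᵐ x ∂(volume.restrict Ω), v x ∈ binaryVectors K)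
    (hlim : ∀ᵐ x ∂(volume.restrict Ω), Tendsto (fun n => u n x) atTop (𝓝 (v x)))
    {δ : ℝ} (hδ : 0 < δ) :
    Tendsto (fun n => volume {x ∈ Ω | δ ≤ Metric.infDist (u n x) (binaryVectors K)}) atTop
      (𝓝 0) := by
  have h := tendstoInMeasure_of_tendsto_ae hu hlim (ENNReal.ofReal δ) (ENNReal.ofReal_pos.2 hδ)
  refine tendsto_of_tendsto_of_tendsto_of_le_of_le tendsto_const_nhds h (fun _ => zero_le)
    fun n => ?_
  have hset : {x ∈ Ω | δ ≤ Metric.infDist (u n x) (binaryVectors K)}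
      = {x | δ ≤ Metric.infDist (u n x) (binaryVectors K)} ∩ Ω := by
    ext x
    exact and_comm
  simp only [hset]
  rw [← Measure.restrict_apply' hΩ]
  refine measure_mono_ae ?_
  filter_upwards [hv] with x hx hxδ
  change ENNReal.ofReal δ ≤ edist (u n x) (v x)
  rw [edist_dist]
  exact ENNReal.ofReal_le_ofReal (le_trans hxδ (Metric.infDist_le_dist_of_mem hx))

end Binary

/-! ### The main theorem. -/

theorem mainTheorem3 {K : ℕ} (Ω : Set Plane) (hΩ : MeasurableSet Ω) (hΩfin : volume Ω ≠ ⊤)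
    (σ lam : ℝ) (hσ : 0 < σ) (hlam : 0 < lam)
    (f : Plane → Fin K → ℝ) (hf : IntegrableOn f Ω volume) :
    -- the minimizers approach `{0,1}^K` in measure as `ε → 0⁺`, uniformly over all minimizers
    (∀ δ : ℝ, 0 < δ → ∀ η : ENNReal, 0 < η → ∀ᶠ ε in 𝓝[>] (0 : ℝ),
      ∀ u : Plane → Fin K → ℝ, IsPottsMinimizer Ω σ lam f ε u →
        volume {x ∈ Ω | δ ≤ Metric.infDist (u x) (binaryVectors K)} ≤ η) ∧
    (∀ (ε : ℕ → ℝ) (u : ℕ → Plane → Fin K → ℝ),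
      (∀ n, 0 < ε n) → Tendsto ε atTop (𝓝 0) →
      (∀ n, IsPottsMinimizer Ω σ lam f (ε n) (u n)) →
      -- up to a subsequence, pointwise convergence a.e. to a binary limit
      (∃ (φ : ℕ → ℕ) (v : Plane → Fin K → ℝ), StrictMono φ ∧
        IsPottsMinimizer Ω σ lam f 0 v ∧
        (∀ᵐ x ∂(volume.restrict Ω), v x ∈ binaryVectors K) ∧
        ∀ᵐ x ∂(volume.restrict Ω), Tendsto (fun n => u (φ n) x) atTop (𝓝 (v x))) ∧
      -- if the whole sequence converges weakly, it converges pointwise a.e. to a binary limit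
      (∀ v : Plane → Fin K → ℝ, IntegrableOn v Ω volume →
        (∀ A : Set Plane, MeasurableSet A → A ⊆ Ω →
          Tendsto (fun n => ∫ x in A, u n x) atTop (𝓝 (∫ x in A, v x))) →
        IsPottsMinimizer Ω σ lam f 0 v ∧
        (∀ᵐ x ∂(volume.restrict Ω), v x ∈ binaryVectors K) ∧
        ∀ᵐ x ∂(volume.restrict Ω), Tendsto (fun n => u n x) atTop (𝓝 (v x)))) ∧
    -- the minimizers of the limiting functional are binary
    (∀ u : Plane → Fin K → ℝ, IsPottsMinimizer Ω σ lam f 0 u →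
      ∀ᵐ x ∂(volume.restrict Ω), u x ∈ binaryVectors K) := by

  have : IsFiniteMeasure (volume.restrict Ω) := isFiniteMeasure_restrict.2 hΩfin
  refine ⟨fun δ hδ η hη => ?_, fun ε u hε0 hε hu => ⟨?_, fun v hv h => ?_⟩, fun u hu => ?_⟩
  -- If the estimate fails for arbitrarily small `ε`, choose a sequence `ε n → 0` with bad
  -- minimizers. A subsequence converges almost everywhere to a binary limit, so the measures of its
  -- bad sets tend to zero, contradicting the lower bound `η`.
  · by_contra hcon
    rw [not_eventually] at hcon
    obtain ⟨ε, hεlim, hε⟩ := exists_seq_forall_of_frequently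
      (hcon.and_eventually eventually_mem_nhdsWithin)
    have hbad : ∀ n, ∃ u : Plane → Fin K → ℝ, IsPottsMinimizer Ω σ lam f (ε n) u ∧
        η < volume {x ∈ Ω | δ ≤ Metric.infDist (u x) (binaryVectors K)} := by
      intro n
      simpa only [not_forall, not_le, exists_prop] using (hε n).1
    choose u hu hlarge using hbad
    obtain ⟨φ, v, -, -, hbin, hlim⟩ := exists_subseq_ae_tendsto hΩ hσ hlam hf
      (fun n => (hε n).2) (hεlim.mono_right nhdsWithin_le_nhds) hu
    have h0 := tendsto_measure_infDist_binaryVectors hΩ (fun n => (hu (φ n)).1.1) hbin hlim hδ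
    obtain ⟨n, hn⟩ := (h0.eventually (gt_mem_nhds hη)).exists
    exact (hlarge (φ n)).not_gt hn
  · exact exists_subseq_ae_tendsto hΩ hσ hlam hf hε0 hε hu
  · have hlim : ∀ k A, MeasurableSet A →
        Tendsto (fun n => ∫ x in A, u n x k ∂(volume.restrict Ω)) atTop
          (𝓝 (∫ x in A, v x k ∂(volume.restrict Ω))) := by
      intro k A hA
      -- The hypothesis concerns only subsets of `Ω`, so it is applied to `A ∩ Ω` and then read
      -- coordinatewise.
      rw [Measure.restrict_restrict hA]
      have hk := tendsto_pi_nhds.1 (h (A ∩ Ω) (hA.inter hΩ) Set.inter_subset_right) k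
      have hint : ∀ n i, Integrable (fun x => u n x i) (volume.restrict (A ∩ Ω)) := fun n i =>
        IntegrableOn.mono_set (simplexFunctions.integrable (hu n).1 i) Set.inter_subset_right
      rw [eval_integral fun i => (hv.mono_set Set.inter_subset_right).eval i] at hk
      simpa only [fun n => eval_integral (hint n)] using hk
    have hvS := mem_simplexFunctions_of_tendsto_setIntegral (fun n => (hu n).1) hv hlim
    have hmin := isPottsMinimizer_of_tendsto_setIntegral hΩ hf hε hu hvS hlim
    exact ⟨hmin, hmin.ae_mem_binaryVectors hΩ hσ hlam hf,
      ae_tendsto_of_tendsto_setIntegral hΩ hσ hlam hf hε0 hε hu hvS hlim⟩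
  · exact hu.ae_mem_binaryVectors hΩ hσ hlam hf
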